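/- A poset $\mathcal P=(X,\le)$ is an interval order if each $x\in X$ can be assigned a nonempty open interval $(l_x,r_x)$ of the real line such that, for all distinct $x,y\in X$, $x\le y$ if and only if $r_x\le l_y$. An interval order extension of a poset $(X,\le)$ is an interval order on $X$ whose order relation contains $\le$. The interval dimension $\operatorname{idim}(\mathcal P)$ of a poset $\mathcal P$ is the smallest positive integer $k$ such that the order relation of $\mathcal P$ is the intersection of $k$ interval order extensions of $\mathcal P$. There is a polynomial-time $O\!\left(\frac{n\sqrt{\log\log n}}{\sqrt{\log n}}\right)$-factor approximation algorithm for computing the interval dimension of any poset on $n$ elements. That is, there are a function $\alpha:\mathbb N\to\mathbb R$ with $\alpha(n)=O\!\left(\frac{n\sqrt{\log\log n}}{\sqrt{\log n}}\right)$ as $n\to\infty$, a polynomial $T$, and an algorithm (a program of a unit-cost random access machine with addition and truncated subtraction) which, given $n\ge 1$ and the $n\times n$ zero-one matrix of the order relation of any poset $\mathcal P$ on $n$ elements (listed in an arbitrary order), halts after at most $T(n)$ steps with a natural number $d$ such that $$\operatorname{idim}(\mathcal P)\le d\le \alpha(n)\cdot\operatorname{idim}(\mathcal P).$$ -/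

import Mathlib

/-! ### Interval orders and interval dimension -/

/-- A partial order `r` on `X` is an interval order if its elements can be assigned nonempty open
intervals `(l x, u x)` of the real line such that, for distinct `x` and `y`, `x` is below `y` if and
only if the interval of `x` lies to the left of that of `y`. -/
def IsIntervalOrder {X : Type*} (r : X → X → Prop) : Prop :=
  IsPartialOrder X r ∧
    ∃ l u : X → ℝ, (∀ x, l x < u x) ∧ ∀ x y, x ≠ y → (r x y ↔ u x ≤ l y)

/-- `r` is the intersection of `k` interval orders, each of which extends `r`. -/
def HasIntervalRealizer {X : Type*} (r : X → X → Prop) (k : ℕ) : Prop :=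
  ∃ Q : Fin k → X → X → Prop,
    (∀ i, IsIntervalOrder (Q i)) ∧ (∀ i x y, r x y → Q i x y) ∧
      ∀ x y, r x y ↔ ∀ i, Q i x y

/-- The interval dimension of a poset: the least positive `k` such that the order is the
intersection of `k` interval order extensions. -/
noncomputable def intervalDim (X : Type*) [PartialOrder X] : ℕ :=
  sInf {k : ℕ | 0 < k ∧ HasIntervalRealizer (fun x y : X => x ≤ y) k}

/-- If `a` is not below `b`, some interval order extension does not put `a` below `b`. -/
theorem exists_intervalOrder_not_le {X : Type*} [PartialOrder X] [Finite X] {a b : X}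
    (hab : ¬ a ≤ b) :
    ∃ r : X → X → Prop, IsIntervalOrder r ∧ (∀ x y, x ≤ y → r x y) ∧ ¬ r a b := by
  classical
  have := Fintype.ofFinite X
  let c : X → ℝ := fun x => ((Finset.univ.filter (fun z => z ≤ x)).card : ℝ)
  let g : X → ℝ := fun x => c x + if a ≤ x then (Fintype.card X : ℝ) else 0
  have hc : ∀ x y, x < y → c x + 1 ≤ c y := by
    intro x y h
    have : (Finset.univ.filter (fun z => z ≤ x)) ⊂ (Finset.univ.filter (fun z => z ≤ y)) := by
      refine Finset.ssubset_iff_of_subset ?_ |>.2 ⟨y, by simp, by simpa using h.not_ge⟩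
      intro z hz
      simp only [Finset.mem_filter, Finset.mem_univ, true_and] at hz ⊢
      exact hz.trans h.le
    have := Finset.card_lt_card this
    simp only [c]
    exact_mod_cast this
  have hg : ∀ x y, x < y → g x + 1 ≤ g y := by
    intro x y h
    have h1 := hc x y h
    simp only [g]
    by_cases hx : a ≤ x
    · simp only [hx, hx.trans h.le, if_true]; linarith
    · by_cases hy : a ≤ y
      · simp only [hx, hy, if_true, if_false]
        have : (0 : ℝ) ≤ Fintype.card X := Nat.cast_nonneg _
        linarith
      · simp only [hx, hy, if_false]; linarith
  refine ⟨fun x y => x = y ∨ g x ≤ g y - 1, ⟨?_, fun x => g x - 1, g, fun x => by linarith, ?_⟩,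
    ?_, ?_⟩
  · exact
      { refl := fun x => Or.inl rfl
        trans := by
          rintro x y z (rfl | h1) (rfl | h2)
          · exact Or.inl rfl
          · exact Or.inr h2
          · exact Or.inr h1
          · exact Or.inr (by linarith)
        antisymm := by
          rintro x y (h1 | h1) (h2 | h2)
          · exact h1
          · exact h1
          · exact h2.symm
          · linarith }
  · intro x y hxy
    simp [hxy]
  · intro x y h
    rcases h.eq_or_lt with h | h
    · exact Or.inl h
    · exact Or.inr (by linarith [hg x y h])
  · rintro (h | h)
    · exact hab h.le
    · have h1 : c b ≤ Fintype.card X := by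
        simp only [c]; exact_mod_cast Finset.card_le_univ _
      have h2 : 0 ≤ c a := Nat.cast_nonneg _
      simp only [g, hab, le_refl, if_true, if_false] at h
      linarith

/-- For a finite poset the minimum that defines the interval dimension is attained. -/
theorem intervalDim_spec (X : Type*) [PartialOrder X] [Finite X] :
    0 < intervalDim X ∧ HasIntervalRealizer (fun x y : X => x ≤ y) (intervalDim X) := by
  classical
  refine Nat.sInf_mem (s := {k : ℕ | 0 < k ∧ HasIntervalRealizer (fun x y : X => x ≤ y) k}) ?_
  by_cases hne : ∃ a b : X, ¬ a ≤ b
  · let S := {p : X × X // ¬ p.1 ≤ p.2}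
    obtain ⟨a, b, hab⟩ := hne
    have hS : Nonempty S := ⟨⟨(a, b), hab⟩⟩
    choose Q h1 h2 h3 using fun p : S => exists_intervalOrder_not_le p.2
    let e := Finite.equivFin S
    refine ⟨Nat.card S, Nat.card_pos, fun i => Q (e.symm i), fun i => h1 _, fun i => h2 _, ?_⟩
    intro x y
    refine ⟨fun h i => h2 _ _ _ h, fun h => ?_⟩
    by_contra hxy
    have : Q (e.symm (e ⟨(x, y), hxy⟩)) x y := h (e ⟨(x, y), hxy⟩)
    rw [Equiv.symm_apply_apply] at this
    exact h3 ⟨(x, y), hxy⟩ this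
  · push Not at hne
    have hsub : ∀ x y : X, x = y := fun x y => le_antisymm (hne x y) (hne y x)
    refine ⟨1, Nat.one_pos, fun _ x y => x ≤ y, fun _ => ⟨inferInstance, fun _ => 0, fun _ => 1,
      fun _ => one_pos, fun x y hxy => (hxy (hsub x y)).elim⟩, fun _ _ _ h => h, ?_⟩
    intro x y
    exact ⟨fun h _ => h, fun h => h 0⟩

/-! ### A random access machine with step count

Programs of a unit-cost random access machine, with structured control flow. The memory consists of
scalar variables and arrays, each named by a number that is fixed in the program text, so that a
program uses only finitely many of them; array cells are addressed by computed indices. All cells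
hold natural numbers. The only arithmetic operations are addition and truncated subtraction, so
that in `t` steps only numbers of `O(t)` more bits than those of the input and of the program
text can be produced, and running times agree with those of Turing machines up to a polynomial. -/

namespace RAM

/-- The contents of the memory. -/
structure Store where
  /-- the values of the scalar variables -/
  var : ℕ → ℕ
  /-- `arr a i` is the cell with index `i` of the array `a` -/
  arr : ℕ → ℕ → ℕ

/-- Arithmetic terms. -/
inductive AExp where
  /-- a literal -/
  | const (c : ℕ)
  /-- the value of a variable -/
  | var (x : ℕ)
  /-- `get a e` reads the cell of the array `a` whose index is the value of `e` -/
  | get (a : ℕ) (e : AExp)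
  /-- addition -/
  | add (e f : AExp)
  /-- truncated subtraction -/
  | sub (e f : AExp)

/-- The value of a term. -/
def AExp.val (s : Store) : AExp → ℕ
  | const c => c
  | var x => s.var x
  | get a e => s.arr a (e.val s)
  | add e f => e.val s + f.val s
  | sub e f => e.val s - f.val s

/-- The number of steps for evaluating a term: one for each operation and each operand in it. -/
def AExp.cost : AExp → ℕ
  | const _ => 1
  | var _ => 1
  | get _ e => e.cost + 1
  | add e f => e.cost + f.cost + 1
  | sub e f => e.cost + f.cost + 1

/-- Programs. -/
inductive Prog where
  /-- do nothing -/
  | skip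
  /-- `assign x e` sets the variable `x` to the value of `e` -/
  | assign (x : ℕ) (e : AExp)
  /-- `put a e f` sets the cell of the array `a` whose index is the value of `e` to the value
  of `f` -/
  | put (a : ℕ) (e f : AExp)
  /-- run `p`, then `q` -/
  | seq (p q : Prog)
  /-- run `p` if the value of `e` is not zero, and `q` otherwise -/
  | cond (e : AExp) (p q : Prog)
  /-- run `p` again and again as long as the value of `e` is not zero -/
  | loop (e : AExp) (p : Prog)

/-- The store after an assignment to a variable. -/
def Store.setVar (s : Store) (x v : ℕ) : Store :=
  { s with var := Function.update s.var x v }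

/-- The store after an assignment to an array cell. -/
def Store.setArr (s : Store) (a i v : ℕ) : Store :=
  { s with arr := Function.update s.arr a (Function.update (s.arr a) i v) }

/-- `Exec p s t s'`: the program `p`, started with the store `s`, halts after exactly `t` steps with
the store `s'`. -/
inductive Exec : Prog → Store → ℕ → Store → Prop
  | skip (s : Store) : Exec .skip s 1 s
  | assign (s : Store) (x : ℕ) (e : AExp) :
      Exec (.assign x e) s (e.cost + 1) (s.setVar x (e.val s))
  | put (s : Store) (a : ℕ) (e f : AExp) :
      Exec (.put a e f) s (e.cost + f.cost + 1) (s.setArr a (e.val s) (f.val s))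
  | seq {p q : Prog} {s s' s'' : Store} {t t' : ℕ} :
      Exec p s t s' → Exec q s' t' s'' → Exec (.seq p q) s (t + t') s''
  | cond_true {e : AExp} {p q : Prog} {s s' : Store} {t : ℕ} :
      e.val s ≠ 0 → Exec p s t s' → Exec (.cond e p q) s (e.cost + 1 + t) s'
  | cond_false {e : AExp} {p q : Prog} {s s' : Store} {t : ℕ} :
      e.val s = 0 → Exec q s t s' → Exec (.cond e p q) s (e.cost + 1 + t) s'
  | loop_true {e : AExp} {p : Prog} {s s' s'' : Store} {t t' : ℕ} :
      e.val s ≠ 0 → Exec p s t s' → Exec (.loop e p) s' t' s'' →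
        Exec (.loop e p) s (e.cost + 1 + t + t') s''
  | loop_false {e : AExp} {p : Prog} {s : Store} :
      e.val s = 0 → Exec (.loop e p) s (e.cost + 1) s

/-- The machine is deterministic. -/
theorem Exec.deterministic {p : Prog} {s s₁ s₂ : Store} {t₁ t₂ : ℕ}
    (h₁ : Exec p s t₁ s₁) (h₂ : Exec p s t₂ s₂) : t₁ = t₂ ∧ s₁ = s₂ := by
  induction h₁ generalizing t₂ s₂ with
  | skip => cases h₂; exact ⟨rfl, rfl⟩
  | assign => cases h₂; exact ⟨rfl, rfl⟩
  | put => cases h₂; exact ⟨rfl, rfl⟩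
  | seq _ _ ih ih' =>
    cases h₂ with
    | seq a b =>
      obtain ⟨rfl, rfl⟩ := ih a
      obtain ⟨rfl, rfl⟩ := ih' b
      exact ⟨rfl, rfl⟩
  | cond_true h _ ih =>
    cases h₂ with
    | cond_true _ a => obtain ⟨rfl, rfl⟩ := ih a; exact ⟨rfl, rfl⟩
    | cond_false h' _ => exact absurd h' h
  | cond_false h _ ih =>
    cases h₂ with
    | cond_true h' _ => exact absurd h h'
    | cond_false _ a => obtain ⟨rfl, rfl⟩ := ih a; exact ⟨rfl, rfl⟩
  | loop_true h _ _ ih ih' =>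
    cases h₂ with
    | loop_true _ a b =>
      obtain ⟨rfl, rfl⟩ := ih a
      obtain ⟨rfl, rfl⟩ := ih' b
      exact ⟨rfl, rfl⟩
    | loop_false h' => exact absurd h' h
  | loop_false h =>
    cases h₂ with
    | loop_true h' _ _ => exact absurd h h'
    | loop_false _ => exact ⟨rfl, rfl⟩

end RAM

/-- The initial store for a binary relation `r` on `n` elements: the variable `0` holds `n`, the
array `0` holds the `n × n` matrix of `r` with entries `0` and `1`, row by row, and all other cells
hold `0`. -/
noncomputable def relationInput (n : ℕ) (r : Fin n → Fin n → Prop) : RAM.Store where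
  var x := if x = 0 then n else 0
  arr a m := by
    classical
    exact if a = 0 ∧ ∃ i j : Fin n, m = (i : ℕ) * n + j ∧ r i j then 1 else 0

/-- The approximation factor `n √(log log n) / √(log n)`. -/
noncomputable def approxRate (n : ℕ) : ℝ :=
  n * Real.sqrt (Real.log (Real.log n)) / Real.sqrt (Real.log n)

/-! Cut the `n` elements into blocks of `k` consecutive ones, where `k` is the largest number with
`k ^ (k * k) ≤ n`. A realizer has to reverse every pair `v`, `y` with `v` not below `y`, and the
pair is charged to the block `V` containing `v`. Only the order of right endpoints inside `V`
matters: a weight `f` on `V` yields an extension without `v` below `y` as soon as `f a < f v` for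
all `a ∈ V` below `y` (`exists_intervalOrder_of_weight`). Conversely, ranking the right endpoints of
an extension gives such a weight (`IsIntervalOrder.exists_weight`).

So the least number of weights that handles one block is at most the interval dimension, while the
weights of all blocks together form a realizer. The sum of the block values therefore lies between
the interval dimension and the number of blocks times it. A family of at most `k` weights with
values below `k` is a table of at most `k * k` digits in base `k`, so there are at most `n` codes to
try and exhaustive search is polynomial. Maximality of `k` gives `log n ≤ 8 k² log log n`
(`log_le_blockSize`), so the number of blocks, at most `2n / k`, has the required order.

Running times come from closure properties of `Comp`, chiefly primitive recursion with polynomially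
bounded values (`Comp.natRec`). -/

/-! ### A calculus of functions computable in polynomial time -/

namespace RAM

/-- The stores `s` and `s'` have the same arrays and the same variables below `w`. -/
def Same (w : ℕ) (s s' : Store) : Prop :=
  (∀ x < w, s'.var x = s.var x) ∧ s'.arr = s.arr

theorem Same.trans {w : ℕ} {s₁ s₂ s₃ : Store} (h : Same w s₁ s₂) (h' : Same w s₂ s₃) :
    Same w s₁ s₃ :=
  ⟨fun x hx => (h'.1 x hx).trans (h.1 x hx), h'.2.trans h.2⟩

theorem Same.mono {w w' : ℕ} {s s' : Store} (h : Same w' s s') (hw : w ≤ w') : Same w s s' :=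
  ⟨fun x hx => h.1 x (hx.trans_le hw), h.2⟩

theorem same_setVar {w x : ℕ} (hx : w ≤ x) (s : Store) (v : ℕ) : Same w s (s.setVar x v) :=
  ⟨fun y hy => Function.update_of_ne (by omega) _ _, rfl⟩

@[simp] theorem setVar_var_self (s : Store) (x v : ℕ) : (s.setVar x v).var x = v :=
  Function.update_self _ _ _

theorem setVar_var_of_ne (s : Store) {x y : ℕ} (h : y ≠ x) (v : ℕ) :
    (s.setVar x v).var y = s.var y :=
  Function.update_of_ne h _ _

/-- A representation of the points of `ι` by stores. A point `a` consists of an input, of size `n a`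
and with the matrix `mat a`, and possibly the values of further variables below `w`. -/
structure World (ι : Type) where
  /-- the number of variables in use -/
  w : ℕ
  /-- the size of the input -/
  n : ι → ℕ
  /-- the input array -/
  mat : ι → ℕ → ℕ
  /-- the store represents the point -/
  R : ι → Store → Prop
  pos : 0 < w
  n_eq : ∀ {a s}, R a s → s.var 0 = n a
  mat_eq : ∀ {a s}, R a s → s.arr 0 = mat a
  stable : ∀ {a s s'}, Same w s s' → R a s → R a s'

/-- The base of polynomial bounds. -/
def World.size {ι : Type} (W : World ι) (a : ι) : ℕ := W.n a + 2

theorem World.two_le_size {ι : Type} (W : World ι) (a : ι) : 2 ≤ W.size a := by simp [World.size]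

/-- The points of `W'` are points of `W` with the values of further variables. -/
structure World.Ext {ι κ : Type} (W : World ι) (W' : World κ) (π : κ → ι) : Prop where
  le : W.w ≤ W'.w
  R : ∀ {q s}, W'.R q s → W.R (π q) s
  n : ∀ q, W'.n q = W.n (π q)
  mat : ∀ q, W'.mat q = W.mat (π q)

/-- The function `F` has polynomial values and, for every `w ≥ W.w`, it is computed into the
variable `w` by a polynomial-time program that leaves the variables below `w` and the arrays as they
are. -/
structure Comp {ι : Type} (W : World ι) (F : ι → ℕ) : Prop where
  bound : ∃ c, ∀ a, F a ≤ W.size a ^ c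
  prog : ∀ w, W.w ≤ w → ∃ p c, ∀ a s, W.R a s →
    ∃ t s', Exec p s t s' ∧ s'.var w = F a ∧ Same w s s' ∧ t ≤ W.size a ^ c

theorem World.Ext.size {ι κ : Type} {W : World ι} {W' : World κ} {π : κ → ι} (h : W.Ext W' π)
    (q : κ) : W'.size q = W.size (π q) := by simp [World.size, h.n]

/-- A program for `W` runs unchanged in `W'`: every store of `W'` is one of `W`, the size is the
same, and the scratch variables of `W'` start no lower. -/
theorem Comp.lift {ι κ : Type} {W : World ι} {W' : World κ} {π : κ → ι} {F : ι → ℕ}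
    (h : Comp W F) (hW : W.Ext W' π) : Comp W' fun q => F (π q) where
  bound := h.bound.imp fun _ hc q => by rw [hW.size]; exact hc _
  prog w hw := by
    obtain ⟨p, c, hp⟩ := h.prog w (hW.le.trans hw)
    exact ⟨p, c, fun q s hs => by rw [hW.size]; exact hp _ s (hW.R hs)⟩

theorem World.Ext.refl {ι : Type} (W : World ι) : W.Ext W id :=
  ⟨le_rfl, fun h => h, fun _ => rfl, fun _ => rfl⟩

theorem World.Ext.trans {ι κ μ : Type} {W : World ι} {W' : World κ} {W'' : World μ} {π : κ → ι}
    {ρ : μ → κ} (h : W.Ext W' π) (h' : W'.Ext W'' ρ) : W.Ext W'' (π ∘ ρ) :=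
  ⟨h.le.trans h'.le, fun hs => h.R (h'.R hs), fun q => (h'.n q).trans (h.n _),
    fun q => (h'.mat q).trans (h.mat _)⟩

/-- Since the base `n + 2` is at least `2`, constants, sums and products are absorbed into the
exponent, and every polynomial bound can be kept as a single power. -/
theorem le_pow_self_of_two_le {z : ℕ} (hz : 2 ≤ z) (m : ℕ) : m ≤ z ^ m :=
  (Nat.lt_two_pow_self (n := m)).le.trans (Nat.pow_le_pow_left hz m)

theorem add_le_pow {z a b c d : ℕ} (hz : 2 ≤ z) (ha : a ≤ z ^ c) (hb : b ≤ z ^ d) :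
    a + b ≤ z ^ (c + d + 1) := by
  have h1 : z ^ c ≤ z ^ (c + d) := Nat.pow_le_pow_right (by omega) (by omega)
  have h2 : z ^ d ≤ z ^ (c + d) := Nat.pow_le_pow_right (by omega) (by omega)
  calc a + b ≤ z ^ (c + d) * 2 := by omega
    _ ≤ z ^ (c + d) * z := Nat.mul_le_mul_left _ hz
    _ = z ^ (c + d + 1) := (pow_succ _ _).symm

theorem mul_le_pow {z a b c d : ℕ} (ha : a ≤ z ^ c) (hb : b ≤ z ^ d) :
    a * b ≤ z ^ (c + d) :=
  (Nat.mul_le_mul ha hb).trans (pow_add _ _ _).ge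

/-! ### Expressions, branching and primitive recursion -/

section Comp

variable {ι : Type} {W : World ι} {F G H N : ι → ℕ}

theorem Comp.congr (h : Comp W F) (hG : ∀ a, G a = F a) : Comp W G :=
  (funext hG : G = F) ▸ h

theorem Comp.of_exp (e : AExp) (he : ∀ a s, W.R a s → e.val s = F a)
    (hb : ∃ c, ∀ a, F a ≤ W.size a ^ c) : Comp W F where
  bound := hb
  prog w _ := ⟨.assign w e, e.cost + 1, fun a s hs => ⟨_, _, .assign s w e,
    (setVar_var_self _ _ _).trans (he a s hs), same_setVar le_rfl _ _,
    le_pow_self_of_two_le (W.two_le_size a) _⟩⟩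

theorem Comp.const (c : ℕ) : Comp W fun _ => c :=
  Comp.of_exp (.const c) (fun _ _ _ => rfl) ⟨c, fun a => le_pow_self_of_two_le (W.two_le_size a) c⟩

theorem Comp.n : Comp W W.n :=
  Comp.of_exp (.var 0) (fun _ _ h => W.n_eq h) ⟨1, fun s => by simp [World.size]⟩

/-- A value computed by an expression from previously computed values. -/
theorem Comp.exp₂ (hF : Comp W F) (hG : Comp W G) (e : ℕ → AExp) (f : ℕ → ℕ → ℕ) (d : ℕ)
    (he : ∀ w, (e w).cost = d) (hef : ∀ w s, (e w).val s = f (s.var w) (s.var (w + 1)))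
    (hb : ∃ c, ∀ a, f (F a) (G a) ≤ W.size a ^ c) : Comp W fun a => f (F a) (G a) where
  bound := hb
  prog w hw := by
    obtain ⟨p, x, hp⟩ := hF.prog w hw
    obtain ⟨q, y, hq⟩ := hG.prog (w + 1) (by omega)
    refine ⟨.seq p (.seq q (.assign w (e w))), x + (y + (d + 1) + 1) + 1, fun a s hs => ?_⟩
    obtain ⟨t₁, s₁, h₁, hv₁, hs₁, ht₁⟩ := hp a s hs
    obtain ⟨t₂, s₂, h₂, hv₂, hs₂, ht₂⟩ := hq a s₁ (W.stable (hs₁.mono hw) hs)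
    have hz := W.two_le_size a
    refine ⟨_, _, .seq h₁ (.seq h₂ (.assign _ _ _)), ?_, ?_, ?_⟩
    · rw [setVar_var_self, hef, hv₂, hs₂.1 w (by omega), hv₁]
    · exact (hs₁.trans (hs₂.mono (by omega))).trans (same_setVar le_rfl _ _)
    · rw [he]
      exact add_le_pow hz ht₁ (add_le_pow hz ht₂ (le_pow_self_of_two_le hz _))

theorem Comp.add (hF : Comp W F) (hG : Comp W G) : Comp W fun a => F a + G a := by
  refine hF.exp₂ hG (fun w => .add (.var w) (.var (w + 1))) (· + ·) 3 (fun _ => rfl)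
    (fun _ _ => rfl) ?_
  obtain ⟨x, hx⟩ := hF.bound
  obtain ⟨y, hy⟩ := hG.bound
  exact ⟨_, fun a => add_le_pow (W.two_le_size a) (hx a) (hy a)⟩

theorem Comp.sub (hF : Comp W F) (hG : Comp W G) : Comp W fun a => F a - G a := by
  refine hF.exp₂ hG (fun w => .sub (.var w) (.var (w + 1))) (· - ·) 3 (fun _ => rfl)
    (fun _ _ => rfl) ?_
  obtain ⟨x, hx⟩ := hF.bound
  exact ⟨x, fun a => (Nat.sub_le _ _).trans (hx a)⟩

theorem Comp.mat (hF : Comp W F) (hb : ∃ c, ∀ a, W.mat a (F a) ≤ W.size a ^ c) :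
    Comp W fun a => W.mat a (F a) where
  bound := hb
  prog w hw := by
    obtain ⟨p, x, hp⟩ := hF.prog w hw
    refine ⟨.seq p (.assign w (.get 0 (.var w))), x + 3 + 1, fun a s hs => ?_⟩
    obtain ⟨t₁, s₁, h₁, hv₁, hs₁, ht₁⟩ := hp a s hs
    have hz := W.two_le_size a
    refine ⟨_, _, .seq h₁ (.assign _ _ _), ?_, ?_, ?_⟩
    · simp only [setVar_var_self, AExp.val, hv₁, hs₁.2, W.mat_eq hs]
    · exact hs₁.trans (same_setVar le_rfl _ _)
    · exact add_le_pow hz ht₁ (le_pow_self_of_two_le hz _)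

theorem Comp.ite_ne_zero (hF : Comp W F) (hG : Comp W G) (hH : Comp W H) :
    Comp W fun a => if F a ≠ 0 then G a else H a where
  bound := by
    obtain ⟨x, hx⟩ := hG.bound
    obtain ⟨y, hy⟩ := hH.bound
    refine ⟨x + y + 1, fun a => le_trans ?_ (add_le_pow (W.two_le_size a) (hx a) (hy a))⟩
    split_ifs <;> omega
  prog w hw := by
    obtain ⟨p, x, hp⟩ := hF.prog w hw
    obtain ⟨q, y, hq⟩ := hG.prog w hw
    obtain ⟨r, z, hr⟩ := hH.prog w hw
    refine ⟨.seq p (.cond (.var w) q r), x + (2 + (y + z) + 1) + 1, fun a s hs => ?_⟩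
    obtain ⟨t₁, s₁, h₁, hv₁, hs₁, ht₁⟩ := hp a s hs
    have hR₁ : W.R a s₁ := W.stable (hs₁.mono hw) hs
    have hz := W.two_le_size a
    by_cases h0 : F a ≠ 0
    · obtain ⟨t₂, s₂, h₂, hv₂, hs₂, ht₂⟩ := hq a s₁ hR₁
      refine ⟨_, _, .seq h₁ (.cond_true (by simpa [AExp.val, hv₁] using h0) h₂), ?_,
        hs₁.trans hs₂, ?_⟩
      · rw [if_pos h0, hv₂]
      · refine add_le_pow hz ht₁ (add_le_pow hz (le_pow_self_of_two_le hz _) (ht₂.trans ?_))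
        exact Nat.pow_le_pow_right (by omega) (by omega)
    · obtain ⟨t₂, s₂, h₂, hv₂, hs₂, ht₂⟩ := hr a s₁ hR₁
      refine ⟨_, _, .seq h₁ (.cond_false (by simpa [AExp.val, hv₁] using h0) h₂), ?_,
        hs₁.trans hs₂, ?_⟩
      · rw [if_neg h0, hv₂]
      · refine add_le_pow hz ht₁ (add_le_pow hz (le_pow_self_of_two_le hz _) (ht₂.trans ?_))
        exact Nat.pow_le_pow_right (by omega) (by omega)

/-- The loop for a primitive recursion. -/
def recProg (w : ℕ) (p : Prog) : Prog :=
  .loop (.sub (.var (w + 2)) (.var (w + 1)))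
    (.seq p (.seq (.assign w (.var (w + 3))) (.assign (w + 1) (.add (.var (w + 1)) (.const 1)))))

/-- Variable `w` holds the current value, `w + 1` the counter, `w + 2` the limit, and `w + 3`
receives the next value from the body. The induction is on the number `k` of remaining rounds. A
round costs at most `K` for the body, `4` for the test and `6` for the two assignments; the final
test costs `4`. -/
theorem recProg_spec {w N K : ℕ} {p : Prog} {s₀ : Store} {g : ℕ → ℕ}
    (hp : ∀ m < N, ∀ s, Same w s₀ s → s.var w = g m → s.var (w + 1) = m →
      ∃ t s', Exec p s t s' ∧ s'.var (w + 3) = g (m + 1) ∧ Same (w + 3) s s' ∧ t ≤ K)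
    (k m : ℕ) (hm : m + k = N) (s : Store) (hs : Same w s₀ s) (hv : s.var w = g m)
    (hi : s.var (w + 1) = m) (hN : s.var (w + 2) = N) :
    ∃ t s', Exec (recProg w p) s t s' ∧ s'.var w = g N ∧ Same w s₀ s' ∧ t ≤ k * (K + 10) + 4 := by
  induction k generalizing m s with
  | zero =>
    refine ⟨_, _, .loop_false ?_, ?_, hs, ?_⟩
    · simp only [AExp.val]; omega
    · rw [hv, ← hm]; rfl
    · simp [AExp.cost]
  | succ k ih =>
    obtain ⟨t₁, s₁, h₁, hv₁, hs₁, ht₁⟩ := hp m (by omega) s hs hv hi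
    set s₂ := s₁.setVar w (AExp.val s₁ (.var (w + 3))) with hs₂
    set s₃ := s₂.setVar (w + 1) (AExp.val s₂ (.add (.var (w + 1)) (.const 1))) with hs₃
    obtain ⟨t, s', h, hv', hs', ht⟩ := ih (m + 1) (by omega) s₃
      (((hs.trans (hs₁.mono (by omega))).trans (same_setVar le_rfl _ _)).trans
        (same_setVar (by omega) _ _))
      (by rw [hs₃, setVar_var_of_ne _ (by omega), hs₂, setVar_var_self]; exact hv₁)
      (by
        rw [hs₃, setVar_var_self]
        simp only [AExp.val]
        rw [hs₂, setVar_var_of_ne _ (by omega), hs₁.1 _ (by omega), hi])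
      (by rw [hs₃, setVar_var_of_ne _ (by omega), hs₂, setVar_var_of_ne _ (by omega),
        hs₁.1 _ (by omega), hN])
    refine ⟨_, _, .loop_true ?_ (.seq h₁ (.seq (.assign _ _ _) (.assign _ _ _))) h, hv', hs', ?_⟩
    · simp only [AExp.val]; omega
    · simp only [AExp.cost]
      rw [add_one_mul]
      omega

/-- Functions defined by primitive recursion with polynomial values. -/
theorem Comp.natRec {G : ι → ℕ → ℕ → ℕ} (c : ℕ) (hN : Comp W N) (hF : Comp W F)
    (hb : ∀ a, ∀ i ≤ N a, Nat.rec (F a) (G a) i ≤ W.size a ^ c)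
    (h : ∀ {κ : Type} (W' : World κ) (π : κ → ι) (i x : κ → ℕ), W.Ext W' π → Comp W' i →
      Comp W' x → (∀ q, i q < N (π q)) → (∀ q, x q ≤ W'.size q ^ c) →
      Comp W' fun q => G (π q) (i q) (x q)) :
    Comp W fun a => Nat.rec (F a) (G a) (N a) where
  bound := ⟨c, fun a => hb a _ le_rfl⟩
  prog w hw := by
    -- A point of `W'` adds a counter and a current value to a point of `W`. Restricting both to
    -- their possible ranges makes them polynomially bounded, as `Comp` demands of every point.
    let W' : World {q : ι × ℕ × ℕ // q.2.1 < N q.1 ∧ q.2.2 ≤ W.size q.1 ^ c} :=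
      { w := w + 3
        n := fun q => W.n q.1.1
        mat := fun q => W.mat q.1.1
        R := fun q s => W.R q.1.1 s ∧ s.var (w + 1) = q.1.2.1 ∧ s.var w = q.1.2.2
        pos := by omega
        n_eq := fun hs => W.n_eq hs.1
        mat_eq := fun hs => W.mat_eq hs.1
        stable := fun hs ⟨h1, h2, h3⟩ => ⟨W.stable (hs.mono (by omega)) h1,
          (hs.1 _ (by omega)).trans h2, (hs.1 _ (by omega)).trans h3⟩ }
    have hext : W.Ext W' fun q => q.1.1 :=
      ⟨by simp only [W']; omega, fun hs => hs.1, fun _ => rfl, fun _ => rfl⟩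
    obtain ⟨cN, hcN⟩ := hN.bound
    obtain ⟨p, d, hp⟩ := (h W' (fun q => q.1.1) (fun q => q.1.2.1) (fun q => q.1.2.2) hext
      (Comp.of_exp (.var (w + 1)) (fun q s hs => hs.2.1)
        ⟨cN, fun q => q.2.1.le.trans (hcN _)⟩)
      (Comp.of_exp (.var w) (fun q s hs => hs.2.2) ⟨c, fun q => q.2.2⟩)
      (fun q => q.2.1) (fun q => q.2.2)).prog (w + 3) le_rfl
    obtain ⟨pF, dF, hpF⟩ := hF.prog w hw
    obtain ⟨pN, dN, hpN⟩ := hN.prog (w + 2) (by omega)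
    refine ⟨.seq pF (.seq pN (.seq (.assign (w + 1) (.const 0)) (recProg w p))),
      dF + (dN + (2 + (cN + (d + 10 + 1) + 4 + 1) + 1) + 1) + 1, fun a s hs => ?_⟩
    have hz := W.two_le_size a
    obtain ⟨t₁, s₁, h₁, hv₁, hs₁, ht₁⟩ := hpF a s hs
    obtain ⟨t₂, s₂, h₂, hv₂, hs₂, ht₂⟩ := hpN a s₁ (W.stable (hs₁.mono hw) hs)
    have hs₃ : Same w s (s₂.setVar (w + 1) 0) :=
      (hs₁.trans (hs₂.mono (by omega))).trans (same_setVar (by omega) _ _)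
    obtain ⟨t₃, s₃, h₃, hv₃, hs₃', ht₃⟩ := recProg_spec (w := w) (N := N a)
      (K := W.size a ^ d) (p := p) (s₀ := s) (g := fun i => Nat.rec (F a) (G a) i)
      (fun m hm s' hs' hx hi => hp ⟨(a, m, Nat.rec (F a) (G a) m), hm, hb a m hm.le⟩ s'
        ⟨W.stable (hs'.mono hw) hs, hi, hx⟩) (N a) 0 (by omega) (s₂.setVar (w + 1) 0)
      hs₃ (by rw [setVar_var_of_ne _ (by omega), hs₂.1 _ (by omega)]; exact hv₁) (by simp)
      (by rw [setVar_var_of_ne _ (by omega)]; exact hv₂)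
    refine ⟨_, _, .seq h₁ (.seq h₂ (.seq (.assign _ _ _) h₃)), hv₃, hs₃', ?_⟩
    refine add_le_pow hz ht₁ (add_le_pow hz ht₂ (add_le_pow hz (le_pow_self_of_two_le hz 2)
      (ht₃.trans (add_le_pow hz (mul_le_pow (hcN a) (add_le_pow hz le_rfl ?_)) ?_))))
    · exact le_pow_self_of_two_le hz _
    · exact le_pow_self_of_two_le hz _

/-! ### Derived closure properties -/

/-- Repeated addition is fast enough because the factors themselves, not just their lengths, are
polynomially bounded. Division by search relies on the same fact. -/
theorem Comp.mul (hF : Comp W F) (hG : Comp W G) : Comp W fun a => F a * G a := by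
  have key : ∀ a i, (Nat.rec 0 (fun _ x => x + G a) i : ℕ) = i * G a := by
    intro a i
    induction i with
    | zero => simp
    | succ i ih => simp only [ih]; ring
  obtain ⟨x, hx⟩ := hF.bound
  obtain ⟨y, hy⟩ := hG.bound
  have := Comp.natRec (G := fun a _ x => x + G a) (x + y) hF (Comp.const 0)
    (fun a i hi => by rw [key]; exact mul_le_pow (hi.trans (hx a)) (hy a))
    fun W' π i x hW _ hx _ _ => hx.add (hG.lift hW)
  simpa only [key] using this

/-- A sum whose terms are bounded by a polynomial. -/
theorem Comp.sum {f : ι → ℕ → ℕ} (c : ℕ) (hN : Comp W N)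
    (hb : ∀ a, ∀ i < N a, f a i ≤ W.size a ^ c)
    (h : ∀ {κ : Type} (W' : World κ) (π : κ → ι) (i : κ → ℕ), W.Ext W' π → Comp W' i →
      (∀ q, i q < N (π q)) → Comp W' fun q => f (π q) (i q)) :
    Comp W fun a => ∑ i ∈ Finset.range (N a), f a i := by
  have key : ∀ a i, (Nat.rec 0 (fun i x => x + f a i) i : ℕ) = ∑ j ∈ Finset.range i, f a j := by
    intro a i
    induction i with
    | zero => simp
    | succ i ih => simp only [ih, Finset.sum_range_succ]
  obtain ⟨x, hx⟩ := hN.bound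
  have := Comp.natRec (G := fun a i x => x + f a i) (x + c) hN (Comp.const 0)
    (fun a i hi => by
      rw [key]
      refine (Finset.sum_le_card_nsmul _ _ (W.size a ^ c) fun j hj =>
        hb a j ((Finset.mem_range.1 hj).trans_le hi)).trans ?_
      simpa using mul_le_pow (hi.trans (hx a)) le_rfl)
    fun W' π i x hW hi hx hlt _ => hx.add (h W' π i hW hi hlt)
  simpa only [key] using this

theorem Comp.min (hF : Comp W F) (hG : Comp W G) : Comp W fun a => Min.min (F a) (G a) :=
  (hF.sub (hF.sub hG)).congr fun a => by omega

/-- Powers, cut off at a given value. -/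
theorem Comp.min_pow (hF : Comp W F) (hG : Comp W G) (hH : Comp W H) (hF0 : ∀ a, 0 < F a) :
    Comp W fun a => Min.min (F a ^ G a) (H a) := by
  have key : ∀ a i, (Nat.rec (Min.min 1 (H a)) (fun _ x => Min.min (x * F a) (H a)) i : ℕ) =
      Min.min (F a ^ i) (H a) := by
    intro a i
    induction i with
    | zero => simp
    | succ i ih =>
      simp only [ih, pow_succ]
      rcases le_total (F a ^ i) (H a) with h | h
      · rw [min_eq_left h]
      -- Once the cap is reached, a positive base keeps the power at or above it, so truncating in
      -- every round agrees with truncating at the end.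
      · have h1 : H a ≤ H a * F a := Nat.le_mul_of_pos_right _ (hF0 a)
        have h2 : H a ≤ F a ^ i * F a := h.trans (Nat.le_mul_of_pos_right _ (hF0 a))
        rw [min_eq_right h, min_eq_right h1, min_eq_right h2]
  obtain ⟨x, hx⟩ := hH.bound
  have := Comp.natRec (G := fun a _ x => Min.min (x * F a) (H a)) x hG
    ((Comp.const 1).min hH)
    (fun a i _ => by rw [key]; exact (min_le_right _ _).trans (hx a))
    fun W' π i x hW _ hx _ _ => (hx.mul (hF.lift hW)).min (hH.lift hW)
  simpa only [key] using this

end Comp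

/-! ### Polynomial-time predicates, bounded quantifiers and bounded search -/

open Classical in
/-- The predicate `P` is decidable in polynomial time. -/
def CompP {ι : Type} (W : World ι) (P : ι → Prop) : Prop := Comp W fun a => if P a then 1 else 0

section CompP

variable {ι : Type} {W : World ι} {F G N : ι → ℕ} {P Q : ι → Prop}

theorem CompP.lift {κ : Type} {W' : World κ} {π : κ → ι} (h : CompP W P) (hW : W.Ext W' π) :
    CompP W' fun q => P (π q) := Comp.lift h hW

theorem CompP.ite [∀ a, Decidable (P a)] (hP : CompP W P) (hF : Comp W F) (hG : Comp W G) :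
    Comp W fun a => if P a then F a else G a := by
  have := Comp.ite_ne_zero hP hF hG
  refine this.congr fun a => ?_
  by_cases h : P a <;> simp [h]

theorem Comp.ne_zero (hF : Comp W F) : CompP W fun a => F a ≠ 0 := by
  have := hF.ite_ne_zero (Comp.const 1) (Comp.const 0)
  unfold CompP
  convert this

theorem Comp.lt (hF : Comp W F) (hG : Comp W G) : CompP W fun a => F a < G a := by
  simpa only [Nat.sub_ne_zero_iff_lt] using (hG.sub hF).ne_zero

open Classical in
theorem CompP.not (hP : CompP W P) : CompP W fun a => ¬ P a := by
  have := (Comp.const (W := W) 1).sub hP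
  refine Comp.congr this fun a => ?_
  by_cases h : P a <;> simp [h]

open Classical in
theorem CompP.and (hP : CompP W P) (hQ : CompP W Q) : CompP W fun a => P a ∧ Q a := by
  have := Comp.mul hP hQ
  refine Comp.congr this fun a => ?_
  by_cases h : P a <;> by_cases h' : Q a <;> simp [h, h']

theorem CompP.imp (hP : CompP W P) (hQ : CompP W Q) : CompP W fun a => P a → Q a := by
  simpa only [not_and, not_not] using (hP.and hQ.not).not

theorem Comp.le (hF : Comp W F) (hG : Comp W G) : CompP W fun a => F a ≤ G a := by
  simpa only [not_lt] using (hG.lt hF).not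

theorem CompP.exists_lt {P : ι → ℕ → Prop} (hN : Comp W N)
    (h : ∀ {κ : Type} (W' : World κ) (π : κ → ι) (i : κ → ℕ), W.Ext W' π → Comp W' i →
      (∀ q, i q < N (π q)) → CompP W' fun q => P (π q) (i q)) :
    CompP W fun a => ∃ i < N a, P a i := by
  classical
  have key : ∀ a, ∑ i ∈ Finset.range (N a), (if P a i then 1 else 0) ≠ 0 ↔ ∃ i < N a, P a i := by
    intro a
    simp
  have := (Comp.sum (f := fun a i => if P a i then 1 else 0) 0 hN
    (fun a i _ => by split_ifs <;> simp) (fun W' π i hW hi hlt => by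
      have := h W' π i hW hi hlt
      unfold CompP at this
      convert this)).ne_zero
  simpa only [key] using this

theorem CompP.forall_lt {P : ι → ℕ → Prop} (hN : Comp W N)
    (h : ∀ {κ : Type} (W' : World κ) (π : κ → ι) (i : κ → ℕ), W.Ext W' π → Comp W' i →
      (∀ q, i q < N (π q)) → CompP W' fun q => P (π q) (i q)) :
    CompP W fun a => ∀ i < N a, P a i := by
  have := (CompP.exists_lt (P := fun a i => ¬ P a i) hN
    fun W' π i hW hi hlt => (h W' π i hW hi hlt).not).not
  simpa only [not_exists, not_and, not_not] using this

theorem Comp.findGreatest {P : ι → ℕ → Prop} [∀ a, DecidablePred (P a)] (hN : Comp W N)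
    (h : ∀ {κ : Type} (W' : World κ) (π : κ → ι) (i : κ → ℕ), W.Ext W' π → Comp W' i →
      (∀ q, i q < N (π q)) → CompP W' fun q => P (π q) (i q + 1)) :
    Comp W fun a => Nat.findGreatest (P a) (N a) := by
  have key : ∀ a i, (Nat.rec 0 (fun i x => if P a (i + 1) then i + 1 else x) i : ℕ) =
      Nat.findGreatest (P a) i := by
    intro a i
    induction i with
    | zero => simp
    | succ i ih => simp only [ih, Nat.findGreatest_succ]
  obtain ⟨c, hc⟩ := hN.bound
  have := Comp.natRec (G := fun a i x => if P a (i + 1) then i + 1 else x) c hN (Comp.const 0)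
    (fun a i hi => by
      rw [key]
      exact (Nat.findGreatest_le _).trans (hi.trans (hc a)))
    fun W' π i x hW hi hx hlt _ => (h W' π i hW hi hlt).ite (hi.add (Comp.const 1)) hx
  simpa only [key] using this

theorem Comp.div (hF : Comp W F) (hG : Comp W G) (hG0 : ∀ a, 0 < G a) :
    Comp W fun a => F a / G a := by
  have key : ∀ a, Nat.findGreatest (fun q => q * G a ≤ F a) (F a) = F a / G a := by
    intro a
    rw [Nat.findGreatest_eq_iff]
    refine ⟨Nat.div_le_self _ _, fun _ => Nat.div_mul_le_self _ _, fun q hq _ h => ?_⟩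
    exact absurd ((Nat.le_div_iff_mul_le (hG0 a)).2 h) (by omega)
  have := Comp.findGreatest (P := fun a q => q * G a ≤ F a) hF fun W' π i hW hi _ =>
    ((hi.add (Comp.const 1)).mul (hG.lift hW)).le (hF.lift hW)
  simpa only [key] using this

theorem Comp.mod (hF : Comp W F) (hG : Comp W G) (hG0 : ∀ a, 0 < G a) :
    Comp W fun a => F a % G a := by
  have := hF.sub ((hF.div hG hG0).mul hG)
  refine this.congr fun a => ?_
  have := Nat.div_add_mod' (F a) (G a)
  omega

theorem Comp.pow (hF : Comp W F) (hG : Comp W G) (hH : Comp W N) (hF0 : ∀ a, 0 < F a)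
    (hb : ∀ a, F a ^ G a ≤ N a) : Comp W fun a => F a ^ G a := by
  simpa only [min_eq_left (hb _)] using hF.min_pow hG hH hF0

end CompP

end RAM

/-! ### The algorithm -/

namespace IntervalDimApprox

open RAM

/-- The size of the blocks. -/
def blockSize (n : ℕ) : ℕ := Nat.findGreatest (fun m => m ^ (m * m) ≤ n) n

/-- The entry with index `i` of the table with code `g`. -/
def digit (k g i : ℕ) : ℕ := g / k ^ i % k

/-- In the block with number `b`, the first `c` weights of the table with code `g` separate `v`
from `y` whenever `v` is in the block and not below `y`. -/
def Separates (n : ℕ) (M : ℕ → ℕ) (k b c g : ℕ) : Prop :=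
  ∀ v < k, b * k + v < n → ∀ y < n, ¬ M ((b * k + v) * n + y) ≠ 0 →
    ∃ j < c, ∀ a < k, b * k + a < n →
      (M ((b * k + a) * n + y) ≠ 0 ∧ ¬ M (y * n + (b * k + a)) ≠ 0) →
        digit k g (j * k + a) < digit k g (j * k + v)

open Classical in
/-- The number of weights used for the block with number `b`. -/
noncomputable def blockValue (n : ℕ) (M : ℕ → ℕ) (k b : ℕ) : ℕ :=
  -- Here `t` counts the weights saved out of `k`. The default `t = 0` needs no test, since `k`
  -- weights always suffice; the bound `k - 1` keeps at least one weight when `k` is positive.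
  k - Nat.findGreatest (fun t => ∃ g < k ^ (k * k), Separates n M k b (k - t) g) (k - 1)

/-- The output of the algorithm. -/
noncomputable def output (n : ℕ) (M : ℕ → ℕ) : ℕ :=
  -- The condition selects the nonempty blocks; the last of them may be incomplete.
  ∑ b ∈ Finset.range n, if b * blockSize n < n then blockValue n M (blockSize n) b else 0

theorem blockSize_le (n : ℕ) : blockSize n ≤ n := Nat.findGreatest_le _

theorem blockSize_pos {n : ℕ} (hn : 1 ≤ n) : 0 < blockSize n :=
  Nat.le_findGreatest hn (by simpa using hn)

theorem blockSize_pow_le {n : ℕ} (hn : 1 ≤ n) :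
    blockSize n ^ (blockSize n * blockSize n) ≤ n :=
  Nat.findGreatest_spec (P := fun m => m ^ (m * m) ≤ n) hn (by simpa using hn)

theorem blockValue_le (n : ℕ) (M : ℕ → ℕ) (k b : ℕ) : blockValue n M k b ≤ k := Nat.sub_le _ _

/-- Inputs: a positive size and a zero-one matrix. -/
abbrev Input := {q : ℕ × (ℕ → ℕ) // 1 ≤ q.1 ∧ ∀ i, q.2 i ≤ 1}

/-- The representation of the inputs. -/
def inputWorld : World Input where
  w := 1
  n q := q.1.1
  mat q := q.1.2
  R q s := s.var 0 = q.1.1 ∧ s.arr 0 = q.1.2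
  pos := one_pos
  n_eq h := h.1
  mat_eq h := h.2
  stable hs h := ⟨(hs.1 0 one_pos).trans h.1, by rw [hs.2, h.2]⟩

/-! ### Polynomial running time of the algorithm -/

section

variable {ι : Type} {W : World ι} {π : ι → Input} {b c g k : ι → ℕ}

theorem comp_mat (hW : inputWorld.Ext W π) {F : ι → ℕ} (hF : Comp W F) :
    Comp W fun a => (π a).1.2 (F a) := by
  have := hF.mat ⟨0, fun a => by rw [hW.mat, pow_zero]; exact (π a).2.2 _⟩
  simp only [hW.mat] at this
  exact this

theorem comp_n (hW : inputWorld.Ext W π) : Comp W fun a => (π a).1.1 :=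
  (Comp.n (W := inputWorld)).lift hW

theorem comp_digit (hW : inputWorld.Ext W π) {i : ι → ℕ} (hk : Comp W k) (hk0 : ∀ a, 0 < k a)
    (hg : Comp W g) (hi : Comp W i) (hb : ∀ a, k a ^ i a ≤ (π a).1.1) :
    Comp W fun a => digit (k a) (g a) (i a) :=
  (hg.div (hk.pow hi (comp_n hW) hk0 hb) fun a => pow_pos (hk0 a) _).mod hk hk0

theorem comp_separates (hW : inputWorld.Ext W π) (hk : Comp W k) (hb : Comp W b) (hc : Comp W c)
    (hg : Comp W g) (hk0 : ∀ a, 0 < k a) (hkn : ∀ a, k a ^ (k a * k a) ≤ (π a).1.1)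
    (hck : ∀ a, c a ≤ k a) :
    CompP W fun a => Separates (π a).1.1 (π a).1.2 (k a) (b a) (c a) (g a) := by
  refine CompP.forall_lt hk fun W₁ π₁ v h₁ hv lv => ?_
  have hW₁ := hW.trans h₁
  replace hk₁ := hk.lift h₁
  replace hb₁ := hb.lift h₁
  refine ((((hb₁.mul hk₁).add hv)).lt (comp_n hW₁)).imp ?_
  refine CompP.forall_lt (comp_n hW₁) fun W₂ π₂ y h₂ hy ly => ?_
  have hW₂ := hW₁.trans h₂
  replace hk₂ := hk₁.lift h₂
  replace hb₂ := hb₁.lift h₂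
  replace hv₂ := hv.lift h₂
  refine (comp_mat hW₂ ((((hb₂.mul hk₂).add hv₂).mul (comp_n hW₂)).add hy)).ne_zero.not.imp ?_
  refine CompP.exists_lt ((hc.lift h₁).lift h₂) fun W₃ π₃ j h₃ hj lj => ?_
  have hW₃ := hW₂.trans h₃
  replace hk₃ := hk₂.lift h₃
  replace hb₃ := hb₂.lift h₃
  replace hy₃ := hy.lift h₃
  refine CompP.forall_lt hk₃ fun W₄ π₄ x h₄ hx lx => ?_
  have hW₄ := hW₃.trans h₄
  replace hk₄ := hk₃.lift h₄
  replace hb₄ := hb₃.lift h₄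
  replace hy₄ := hy₃.lift h₄
  replace hj₄ := hj.lift h₄
  replace hv₄ := (hv₂.lift h₃).lift h₄
  replace hg₄ := (((hg.lift h₁).lift h₂).lift h₃).lift h₄
  have hbx := (hb₄.mul hk₄).add hx
  -- The digit positions in use are below `k * k`, so the powers needed to extract digits never
  -- exceed `n`.
  have small : ∀ (κ : ι) (j x : ℕ), j < c κ → x < k κ → k κ ^ (j * k κ + x) ≤ (π κ).1.1 := by
    intro κ j x hj hx
    refine (Nat.pow_le_pow_right (hk0 κ) ?_).trans (hkn κ)
    have : (j + 1) * k κ ≤ k κ * k κ := Nat.mul_le_mul_right _ (hj.trans_le (hck κ))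
    rw [add_one_mul] at this
    omega
  refine (hbx.lt (comp_n hW₄)).imp (CompP.imp ?_ ?_)
  · exact (comp_mat hW₄ ((hbx.mul (comp_n hW₄)).add hy₄)).ne_zero.and
      (comp_mat hW₄ ((hy₄.mul (comp_n hW₄)).add hbx)).ne_zero.not
  · exact (comp_digit hW₄ hk₄ (fun _ => hk0 _) hg₄ ((hj₄.mul hk₄).add hx)
      fun q => small _ _ _ (lj _) (lx _)).lt
      (comp_digit hW₄ hk₄ (fun _ => hk0 _) hg₄ ((hj₄.mul hk₄).add hv₄)
      fun q => small _ _ _ (lj _) (lv _))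

-- The search runs through at most `n` codes because `k ^ (k * k) ≤ n`; this is what dictates the
-- block size.
open Classical in
theorem comp_blockValue (hW : inputWorld.Ext W π) (hk : Comp W k) (hb : Comp W b)
    (hk0 : ∀ a, 0 < k a) (hkn : ∀ a, k a ^ (k a * k a) ≤ (π a).1.1) :
    Comp W fun a => blockValue (π a).1.1 (π a).1.2 (k a) (b a) := by
  refine hk.sub (Comp.findGreatest (hk.sub (Comp.const 1)) fun W₁ π₁ t h₁ ht _ => ?_)
  have hk₁ := hk.lift h₁
  refine CompP.exists_lt (hk₁.pow (hk₁.mul hk₁) (comp_n (hW.trans h₁)) (fun _ => hk0 _)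
    fun _ => hkn _) fun W₂ π₂ g h₂ hg _ => ?_
  exact comp_separates ((hW.trans h₁).trans h₂) (hk₁.lift h₂) ((hb.lift h₁).lift h₂)
    ((hk₁.sub (ht.add (Comp.const 1))).lift h₂) hg (fun _ => hk0 _) (fun _ => hkn _)
    fun _ => Nat.sub_le _ _

end

theorem comp_blockSize : Comp inputWorld fun q => blockSize q.1.1 := by
  refine Comp.findGreatest (comp_n (World.Ext.refl _)) fun W π i hW hi _ => ?_
  have hi' := hi.add (Comp.const 1)
  -- Capping the power at `n + 1` does not affect its comparison with `n`.
  have := (hi'.min_pow (hi'.mul hi') ((comp_n hW).add (Comp.const 1)) fun _ => by omega).le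
    (comp_n hW)
  refine (funext fun a => propext ?_ :
    (fun a => (i a + 1) ^ ((i a + 1) * (i a + 1)) ≤ (π a).1.1) = _) ▸ this
  omega

theorem comp_output : Comp inputWorld fun q => output q.1.1 q.1.2 := by
  have hn : Comp inputWorld fun q => q.1.1 := comp_n (World.Ext.refl _)
  refine Comp.sum 1 hn (fun q b _ => ?_) fun W π b hW hb _ => ?_
  · have h1 := blockValue_le q.1.1 q.1.2 (blockSize q.1.1) b
    have h2 := blockSize_le q.1.1
    have h3 : inputWorld.size q = q.1.1 + 2 := rfl
    rw [h3, pow_one]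
    split_ifs <;> omega
  · have hk := comp_blockSize.lift hW
    exact CompP.ite ((hb.mul hk).lt (comp_n hW)) (comp_blockValue hW hk hb
      (fun a => blockSize_pos (π a).2.1) fun a => blockSize_pow_le (π a).2.1) (Comp.const 0)

theorem exists_prog : ∃ (p : Prog) (T : Polynomial ℕ), ∀ (n : ℕ) (M : ℕ → ℕ) (s : Store), 1 ≤ n →
    (∀ i, M i ≤ 1) → s.var 0 = n → s.arr 0 = M →
      ∃ t s', Exec p s t s' ∧ t ≤ T.eval n ∧ s'.var 0 = output n M := by
  obtain ⟨p, c, hp⟩ := comp_output.prog 1 le_rfl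
  -- The result is computed in variable `1`, the first free one; copying it to variable `0` takes
  -- `2` steps.
  refine ⟨.seq p (.assign 0 (.var 1)), (Polynomial.X + 2) ^ c + 2, fun n M s hn hM h0 hM0 => ?_⟩
  obtain ⟨t, s', h, hv, -, ht⟩ := hp ⟨(n, M), hn, hM⟩ s ⟨h0, hM0⟩
  refine ⟨_, _, .seq h (.assign _ _ _), ?_, ?_⟩
  · have h3 : inputWorld.size ⟨(n, M), hn, hM⟩ = n + 2 := rfl
    rw [h3] at ht
    simpa [AExp.cost] using ht
  · rw [setVar_var_self]; exact hv

end IntervalDimApprox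

/-! ### Interval order extensions from weights -/

/-- The left endpoint `l x` orders elements lexicographically, by the largest `f a + 1` over `a ∈ V`
below `x` and then by the size of the down-set of `x`; so `l` is strictly increasing. The right
endpoint `u x` is the least left endpoint strictly above `x`, or `B` if nothing is above. If all `a
∈ V` below `y` have `f a < f v`, then `m y ≤ f v`, whereas `m z > f v` for every `z > v`; hence `l y
< u v`. -/
theorem exists_intervalOrder_of_weight {X : Type*} [PartialOrder X] [Finite X] (V : Set X)
    (f : X → ℕ) :
    ∃ r : X → X → Prop, IsIntervalOrder r ∧ (∀ x y, x ≤ y → r x y) ∧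
      ∀ v ∈ V, ∀ y, ¬ v ≤ y → (∀ a ∈ V, a < y → f a < f v) → ¬ r v y := by
  classical
  have := Fintype.ofFinite X
  let h : X → ℕ := fun x => (Finset.univ.filter (· ≤ x)).card
  let m : X → ℕ := fun x => (Finset.univ.filter fun a => a ∈ V ∧ a < x).sup fun a => f a + 1
  let C := Fintype.card X + 1
  let l : X → ℕ := fun x => m x * C + h x
  let B := ∑ x, l x + 1
  let u : X → ℕ := fun x => sInf {i | (∃ y, x < y ∧ l y = i) ∨ i = B}
  have hh : ∀ x, h x < C := fun x => Nat.lt_succ_of_le (Finset.card_le_univ _)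
  have hl : ∀ x y, x < y → l x < l y := by
    intro x y hxy
    refine Nat.add_lt_add_of_le_of_lt (Nat.mul_le_mul_right _ (Finset.sup_mono ?_))
      (Finset.card_lt_card ((Finset.ssubset_iff_of_subset ?_).2 ⟨y, by simp, ?_⟩))
    · intro a ha
      simp only [Finset.mem_filter, Finset.mem_univ, true_and] at ha ⊢
      exact ⟨ha.1, ha.2.trans hxy⟩
    · intro a ha
      simp only [Finset.mem_filter, Finset.mem_univ, true_and] at ha ⊢
      exact ha.trans hxy.le
    · simpa using hxy.not_ge
  have hB : ∀ x, l x < B := fun x =>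
    Nat.lt_succ_of_le (Finset.single_le_sum (f := l) (fun _ _ => Nat.zero_le _) (Finset.mem_univ x))
  have hu : ∀ x, (∃ y, x < y ∧ l y = u x) ∨ u x = B := fun x =>
    Nat.sInf_mem (s := {i | (∃ y, x < y ∧ l y = i) ∨ i = B}) ⟨B, Or.inr rfl⟩
  have hul : ∀ x y, x < y → u x ≤ l y := fun x y hxy => Nat.sInf_le (Or.inl ⟨y, hxy, rfl⟩)
  have hlu : ∀ x, l x < u x := by
    intro x
    rcases hu x with ⟨y, hxy, hy⟩ | hx
    · exact (hl x y hxy).trans_eq hy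
    · exact (hB x).trans_eq hx.symm
  refine ⟨fun x y => x = y ∨ u x ≤ l y, ⟨?_, fun x => l x, fun x => u x,
    fun x => Nat.cast_lt.2 (hlu x), fun x y hxy => by simp [hxy]⟩, ?_, ?_⟩
  · exact
      { refl := fun x => Or.inl rfl
        trans := by
          rintro x y z (rfl | h1) (rfl | h2)
          · exact Or.inl rfl
          · exact Or.inr h2
          · exact Or.inr h1
          · exact Or.inr (by have := hlu y; omega)
        antisymm := by
          rintro x y (h1 | h1) (h2 | h2)
          · exact h1
          · exact h1
          · exact h2.symm
          · have := hlu x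
            have := hlu y
            omega }
  · intro x y hxy
    exact hxy.eq_or_lt.imp id (hul x y)
  · rintro v hv y hvy hf (rfl | hvy')
    · exact hvy le_rfl
    · refine hvy'.not_gt ?_
      rcases hu v with ⟨z, hvz, hz⟩ | hv
      · rw [← hz]
        have h1 : m y ≤ f v := Finset.sup_le fun a ha => by
          simp only [Finset.mem_filter, Finset.mem_univ, true_and] at ha
          exact hf a ha.1 ha.2
        have h2 : f v + 1 ≤ m z := Finset.le_sup (f := fun a => f a + 1) (by simp [hv, hvz])
        calc m y * C + h y < (m y + 1) * C := by have := hh y; rw [add_one_mul]; omega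
          _ ≤ m z * C := Nat.mul_le_mul_right _ (by omega)
          _ ≤ l z := Nat.le_add_right _ _
      · exact (hB y).trans_eq hv.symm

theorem hasIntervalRealizer_of_weights {X J : Type*} [PartialOrder X] [Finite X] [Fintype J]
    (V : J → Set X) (f : J → X → ℕ)
    (h : ∀ v y : X, ¬ v ≤ y → ∃ j, v ∈ V j ∧ ∀ a ∈ V j, a < y → f j a < f j v) :
    HasIntervalRealizer (fun x y : X => x ≤ y) (Fintype.card J) := by
  choose r h1 h2 h3 using fun j => exists_intervalOrder_of_weight (V j) (f j)
  let e := Fintype.equivFin J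
  refine ⟨fun i => r (e.symm i), fun i => h1 _, fun i => h2 _, fun x y =>
    ⟨fun hxy i => h2 _ _ _ hxy, fun hxy => ?_⟩⟩
  by_contra hn
  obtain ⟨j, hj, hf⟩ := h x y hn
  refine h3 j x hj y hn hf ?_
  simpa using hxy (e j)

/-- Conversely, each interval order extension gives weights. -/
theorem IsIntervalOrder.exists_weight {X : Type*} [PartialOrder X] {r : X → X → Prop}
    (hr : IsIntervalOrder r) (hle : ∀ x y, x ≤ y → r x y) {k : ℕ} (S : Finset ℕ)
    (hS : ∀ a ∈ S, a < k) (E : ℕ → X) :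
    ∃ f : ℕ → ℕ, (∀ a ∈ S, f a < k) ∧
      ∀ v ∈ S, ∀ y, ¬ r (E v) y → ∀ a ∈ S, E a < y → f a < f v := by
  classical
  obtain ⟨hp, l, u, hlu, h⟩ := hr
  -- The weight is the rank of the right endpoint within `S`. If `E v` is not put below `y` but `E a
  -- < y`, then `u (E a) ≤ l y < u (E v)`.
  refine ⟨fun v => (S.filter fun a => u (E a) < u (E v)).card, fun v hv => ?_,
    fun v hv y hvy a ha hay => ?_⟩
  · calc (S.filter fun a => u (E a) < u (E v)).card < S.card :=
        Finset.card_lt_card (Finset.filter_ssubset.2 ⟨v, hv, by simp⟩)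
      _ ≤ (Finset.range k).card := Finset.card_le_card fun a ha => Finset.mem_range.2 (hS a ha)
      _ = k := Finset.card_range k
  · have hne : E v ≠ y := by
      rintro rfl
      exact hvy (hp.refl _)
    have h1 : l y < u (E v) := by
      rw [h _ _ hne] at hvy
      exact lt_of_not_ge hvy
    have h2 : u (E a) ≤ l y := (h _ _ hay.ne).1 (hle _ _ hay.le)
    refine Finset.card_lt_card ((Finset.ssubset_iff_of_subset ?_).2 ⟨a, ?_, by simp⟩)
    · intro x hx
      simp only [Finset.mem_filter] at hx ⊢
      exact ⟨hx.1, by linarith⟩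
    · simp only [Finset.mem_filter]
      exact ⟨ha, by linarith⟩

/-! ### Comparison of the output with the interval dimension -/

namespace IntervalDimApprox

theorem exists_digit {k : ℕ} (L : ℕ) (F : ℕ → ℕ) (hF : ∀ i < L, F i < k) :
    ∃ g < k ^ L, ∀ i < L, digit k g i = F i := by
  induction L generalizing F with
  | zero => exact ⟨0, by simp, by simp⟩
  | succ L ih =>
    obtain ⟨g, hg, hd⟩ := ih (fun i => F (i + 1)) fun i hi => hF _ (by omega)
    have h0 := hF 0 (by omega)
    refine ⟨F 0 + k * g, ?_, fun i hi => ?_⟩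
    · calc F 0 + k * g < k * (g + 1) := by rw [mul_add_one]; omega
        _ ≤ k * k ^ L := Nat.mul_le_mul_left _ hg
        _ = k ^ (L + 1) := by ring
    · cases i with
      | zero => simp [digit, Nat.mod_eq_of_lt h0]
      | succ i =>
        rw [← hd i (by omega), digit, digit, pow_succ', ← Nat.div_div_eq_div_mul,
          Nat.add_mul_div_left _ _ (by omega), Nat.div_eq_of_lt h0, zero_add]

section

variable {X : Type*} [PartialOrder X] {n : ℕ} {M : ℕ → ℕ} {E : ℕ → X}

theorem separates_iff (hM : ∀ i < n, ∀ j < n, M (i * n + j) ≠ 0 ↔ E i ≤ E j) {k b c g : ℕ} :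
    Separates n M k b c g ↔ ∀ v < k, b * k + v < n → ∀ y < n, ¬ E (b * k + v) ≤ E y →
      ∃ j < c, ∀ a < k, b * k + a < n → E (b * k + a) < E y →
        digit k g (j * k + a) < digit k g (j * k + v) := by
  unfold Separates
  refine forall₂_congr fun v _ => forall_congr' fun hvn => forall₂_congr fun y hy => ?_
  rw [hM _ hvn _ hy]
  refine forall_congr' fun _ => exists_congr fun j => and_congr_right fun _ =>
    forall₂_congr fun a _ => forall_congr' fun han => ?_
  rw [hM _ han _ hy, hM _ hy _ han, lt_iff_le_not_ge (a := E (b * k + a))]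

theorem exists_weights_blockValue (hM : ∀ i < n, ∀ j < n, M (i * n + j) ≠ 0 ↔ E i ≤ E j)
    (k b : ℕ) : ∃ f : ℕ → ℕ → ℕ, ∀ v < k, b * k + v < n → ∀ y < n, ¬ E (b * k + v) ≤ E y →
      ∃ j < blockValue n M k b, ∀ a < k, b * k + a < n → E (b * k + a) < E y →
        f j a < f j v := by
  classical
  by_cases h0 : Nat.findGreatest (fun t => ∃ g < k ^ (k * k), Separates n M k b (k - t) g)
      (k - 1) = 0
  -- With `k` weights available, weight `j` can be the indicator of element `j`: no `a` below `y`
  -- equals `v`, so weight `v` separates `v` from `y`.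
  · refine ⟨fun j a => if a = j then 1 else 0, fun v hv _ y _ hvy => ⟨v, ?_, fun a _ _ hay => ?_⟩⟩
    · rw [blockValue]
      convert hv
      refine (congrArg (k - ·) ?_ : _ = k - 0)
      convert h0
    · have : a ≠ v := by
        rintro rfl
        exact hvy hay.le
      simp [this]
  · obtain ⟨g, -, hg⟩ := Nat.findGreatest_of_ne_zero rfl h0
    rw [separates_iff hM] at hg
    refine ⟨fun j a => digit k g (j * k + a), ?_⟩
    rw [blockValue]
    convert hg

theorem blockValue_pos {k : ℕ} (hk : 0 < k) (b : ℕ) : 0 < blockValue n M k b := by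
  classical
  have := Nat.findGreatest_le (P := fun t => ∃ g < k ^ (k * k), Separates n M k b (k - t) g) (k - 1)
  rw [blockValue]
  refine Nat.sub_pos_of_lt (lt_of_le_of_lt (b := k - 1) ?_ (by omega))
  convert this

/-- For `d < k`, the endpoint ranks of the `d` extensions, restricted to the block, form a table
that the search accepts: each `v` not below `y` is separated by an extension that does not put `v`
below `y`. -/
theorem blockValue_le_of_hasIntervalRealizer
    (hM : ∀ i < n, ∀ j < n, M (i * n + j) ≠ 0 ↔ E i ≤ E j) (k b : ℕ) {d : ℕ} (hd : 0 < d)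
    (h : HasIntervalRealizer (fun x y : X => x ≤ y) d) : blockValue n M k b ≤ d := by
  classical
  rcases le_or_gt k d with hkd | hdk
  · exact (blockValue_le _ _ _ _).trans hkd
  obtain ⟨Q, hQ, hle, hQle⟩ := h
  choose f hfk hf using fun i => (hQ i).exists_weight (hle i) (k := k)
    ((Finset.range k).filter fun a => b * k + a < n)
    (fun a ha => Finset.mem_range.1 (Finset.mem_filter.1 ha).1) (fun a => E (b * k + a))
  simp only [Finset.mem_filter, Finset.mem_range] at hf hfk
  -- Row `j < d` of the table holds the weights of extension `j`; unused entries are `0`.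
  obtain ⟨g, hg, hd'⟩ := exists_digit (k := k) (k * k)
    (fun i => if h : i / k < d ∧ b * k + i % k < n then f ⟨i / k, h.1⟩ (i % k) else 0) (by
      intro i hi
      split_ifs with h
      · exact hfk _ _ ⟨Nat.mod_lt _ (by omega), h.2⟩
      · omega)
  have hdig : ∀ (j : Fin d) (a : ℕ), a < k → b * k + a < n → digit k g (j * k + a) = f j a := by
    intro j a ha han
    have h1 : (j * k + a) / k = j := by
      rw [Nat.mul_comm, Nat.mul_add_div (by omega), Nat.div_eq_of_lt ha, add_zero]
    have h2 : (j * k + a) % k = a := by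
      rw [Nat.mul_comm, Nat.mul_add_mod, Nat.mod_eq_of_lt ha]
    have h3 : j * k + a < k * k := by
      have : ((j : ℕ) + 1) * k ≤ k * k := Nat.mul_le_mul_right _ (by omega)
      rw [add_one_mul] at this
      omega
    rw [hd' _ h3, dif_pos (by rw [h1, h2]; exact ⟨j.2, han⟩)]
    simp only [h1, h2]
  have key : ∃ g < k ^ (k * k), Separates n M k b (k - (k - d)) g := by
    refine ⟨g, hg, (separates_iff hM).2 fun v hv hvn y hy hvy => ?_⟩
    obtain ⟨j, hj⟩ := not_forall.1 (mt (hQle _ _).2 hvy)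
    refine ⟨j, by omega, fun a ha han hay => ?_⟩
    rw [hdig j a ha han, hdig j v hv hvn]
    exact hf j v ⟨hv, hvn⟩ _ hj a ⟨ha, han⟩ hay
  have := Nat.le_findGreatest (P := fun t => ∃ g < k ^ (k * k), Separates n M k b (k - t) g)
    -- Positivity of `d` puts the saving `k - d` within the range of the search.
    (show k - d ≤ k - 1 by omega) key
  rw [blockValue, Nat.sub_le_iff_le_add]
  refine (show k ≤ d + (k - d) by omega).trans (Nat.add_le_add_left ?_ _)
  convert this

/-- The number of blocks. -/
def numBlocks (n : ℕ) : ℕ := ((Finset.range n).filter fun b => b * blockSize n < n).card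

theorem output_le_numBlocks_mul (hM : ∀ i < n, ∀ j < n, M (i * n + j) ≠ 0 ↔ E i ≤ E j) {d : ℕ}
    (hd : 0 < d) (h : HasIntervalRealizer (fun x y : X => x ≤ y) d) :
    output n M ≤ numBlocks n * d := by
  rw [output, ← Finset.sum_filter, numBlocks]
  exact Finset.sum_le_card_nsmul _ _ _ fun b _ =>
    blockValue_le_of_hasIntervalRealizer hM _ b hd h

theorem output_pos (hn : 1 ≤ n) : 0 < output n M := by
  refine (blockValue_pos (n := n) (M := M) (blockSize_pos hn) 0).trans_le ?_
  have := Finset.single_le_sum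
    (f := fun b => if b * blockSize n < n then blockValue n M (blockSize n) b else 0)
    (fun _ _ => Nat.zero_le _) (Finset.mem_range.2 hn)
  simpa [output, show 0 < n from hn] using this

/-- The weights of a block separate its elements from every `y` in the poset, not only from those in
the block, so no pair across blocks is missed. -/
theorem intervalDim_le_output [Finite X] (hn : 1 ≤ n)
    (hM : ∀ i < n, ∀ j < n, M (i * n + j) ≠ 0 ↔ E i ≤ E j) (idx : X → ℕ) (hidx : ∀ x, idx x < n)
    (hE : ∀ x, E (idx x) = x) (hidx' : ∀ i < n, idx (E i) = i) : intervalDim X ≤ output n M := by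
  refine Nat.sInf_le ⟨output_pos hn, ?_⟩
  have hk := blockSize_pos hn
  set k := blockSize n with hkdef
  choose f hf using fun b => exists_weights_blockValue hM k b
  -- One extension for each block and each of its weights; the cardinality is `output n M`.
  let J := Σ b : Fin n, Fin (if (b : ℕ) * k < n then blockValue n M k b else 0)
  have hJ : Fintype.card J = output n M := by
    simp only [J, Fintype.card_sigma, Fintype.card_fin, output]
    rw [Finset.sum_range]
  rw [← hJ]
  refine hasIntervalRealizer_of_weights
    (fun j : J => {x | ∃ a < k, (j.1 : ℕ) * k + a < n ∧ E (j.1 * k + a) = x})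
    (fun j x => f j.1 j.2 (idx x - j.1 * k)) fun v y hvy => ?_
  have hdm : idx v / k * k + idx v % k = idx v := Nat.div_add_mod' _ _
  have hmod : idx v % k < k := Nat.mod_lt _ hk
  have hlt := hidx v
  have hblock : idx v / k * k < n := by omega
  have hEv : E (idx v / k * k + idx v % k) = v := by rw [hdm, hE]
  obtain ⟨j, hj, hjf⟩ := hf (idx v / k) (idx v % k) hmod (by omega) (idx y) (hidx y)
    (by rw [hEv, hE]; exact hvy)
  refine ⟨⟨⟨idx v / k, (Nat.div_le_self _ _).trans_lt hlt⟩, ⟨j, by simp [hblock, hj]⟩⟩,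
    ⟨_, hmod, by simp [hdm, hlt], hEv⟩, ?_⟩
  rintro _ ⟨a, ha, han, rfl⟩ hay
  have := hjf a ha han (by rw [hE]; exact hay)
  simp only
  rw [hidx' _ han, Nat.add_sub_cancel_left, show idx v - idx v / k * k = idx v % k by omega]
  exact this

end

end IntervalDimApprox

/-! ### The approximation factor -/

namespace IntervalDimApprox

theorem numBlocks_mul_le {n : ℕ} (hn : 1 ≤ n) : numBlocks n * blockSize n ≤ 2 * n := by
  have hk := blockSize_pos hn
  have hkn := blockSize_le n
  have : numBlocks n ≤ (Finset.range (n / blockSize n + 1)).card := by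
    refine Finset.card_le_card fun b hb => ?_
    simp only [Finset.mem_filter, Finset.mem_range] at hb ⊢
    exact Nat.lt_succ_of_le ((Nat.le_div_iff_mul_le hk).2 hb.2.le)
  rw [Finset.card_range] at this
  calc numBlocks n * blockSize n ≤ (n / blockSize n + 1) * blockSize n :=
        Nat.mul_le_mul_right _ this
    _ = n / blockSize n * blockSize n + blockSize n := by ring
    _ ≤ n + n := Nat.add_le_add (Nat.div_mul_le_self _ _) hkn
    _ = 2 * n := by ring

/-- Maximality of `k` gives `log n ≤ (k + 1)² log (k + 1)`. The crude bound `k + 1 ≤ (log n)²` turns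
the last factor into `2 log log n`, and `k + 1 ≤ 2k` produces the constant `8`. -/
theorem log_le_blockSize {n : ℕ} (hL : 3 ≤ Real.log n) :
    Real.log n ≤ 8 * (blockSize n : ℝ) ^ 2 * Real.log (Real.log n) := by
  have hn1 : 1 ≤ n := by
    rcases Nat.eq_zero_or_pos n with rfl | h
    · norm_num at hL
    · exact h
  have hn : (0 : ℝ) < n := by exact_mod_cast hn1
  set k := blockSize n with hk
  have hk0 : 0 < k := blockSize_pos hn1
  have hk1 : (1 : ℝ) ≤ k := by exact_mod_cast hk0
  -- The search for `k` stops at `n`, so maximality says something about `k + 1` only if `k + 1 ≤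
  -- n`.
  have hkn : k < n := by
    refine lt_of_le_of_ne (blockSize_le n) fun h => ?_
    have h1 := blockSize_pow_le hn1
    rw [← hk, h] at h1
    have h2 : 1 < n := by
      by_contra h'
      have : n = 1 := by omega
      subst this
      norm_num at hL
    have h3 : n ^ 2 ≤ n ^ (n * n) := Nat.pow_le_pow_right hn1 (by nlinarith)
    nlinarith
  have hup : n < (k + 1) ^ ((k + 1) * (k + 1)) := by
    by_contra h
    have := Nat.le_findGreatest (P := fun m => m ^ (m * m) ≤ n) hkn (not_lt.1 h)
    change k + 1 ≤ k at this
    omega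
  have hup' : Real.log n ≤ ((k : ℝ) + 1) ^ 2 * Real.log (k + 1) := by
    have h1 : (n : ℝ) ≤ ((k : ℝ) + 1) ^ ((k + 1) * (k + 1)) := by exact_mod_cast hup.le
    have h2 := Real.log_le_log hn h1
    rw [Real.log_pow] at h2
    push_cast at h2
    rw [sq]
    exact h2
  have hlow : (k : ℝ) + 1 ≤ Real.log n ^ 2 := by
    rcases Nat.lt_or_ge k 2 with h | h
    · have : (k : ℝ) ≤ 1 := by exact_mod_cast Nat.lt_succ_iff.1 h
      nlinarith
    -- For `k ≥ 2` this yields `k ≤ k² log 2 ≤ log n`, which is more than enough.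
    · have h1 : (2 : ℝ) ^ (k * k) ≤ n := by
        exact_mod_cast (Nat.pow_le_pow_left h _).trans (blockSize_pow_le hn1)
      have h2 := Real.log_le_log (by positivity) h1
      rw [Real.log_pow] at h2
      push_cast at h2
      have h3 := Real.log_two_gt_d9
      have h4 : (2 : ℝ) ≤ k := by exact_mod_cast h
      have h5 : (k : ℝ) * 1 ≤ k * k * Real.log 2 := by
        rw [mul_assoc]
        exact mul_le_mul_of_nonneg_left (by nlinarith) (by linarith)
      nlinarith
  have hlog : Real.log ((k : ℝ) + 1) ≤ 2 * Real.log (Real.log n) := by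
    have := Real.log_le_log (by linarith) hlow
    rw [Real.log_pow] at this
    exact_mod_cast this
  have hLL : 0 ≤ Real.log (Real.log n) := Real.log_nonneg (by linarith)
  calc Real.log n ≤ ((k : ℝ) + 1) ^ 2 * Real.log (k + 1) := hup'
    _ ≤ (2 * (k : ℝ)) ^ 2 * (2 * Real.log (Real.log n)) := by
        refine mul_le_mul (pow_le_pow_left₀ (by linarith) (by linarith) 2) hlog
          (Real.log_nonneg (by linarith)) (by positivity)
    _ = 8 * (k : ℝ) ^ 2 * Real.log (Real.log n) := by ring

theorem numBlocks_isBigO : (fun n => (numBlocks n : ℝ)) =O[Filter.atTop] approxRate := by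
  have hlog : ∀ᶠ n : ℕ in Filter.atTop, 3 ≤ Real.log n :=
    (Real.tendsto_log_atTop.comp tendsto_natCast_atTop_atTop).eventually_ge_atTop 3
  -- The `2` comes from `numBlocks_mul_le`, the root from `log_le_blockSize`.
  refine Asymptotics.IsBigO.of_bound (2 * Real.sqrt 8) ?_
  filter_upwards [hlog, Filter.eventually_ge_atTop 1] with n hL hn
  have hk : (0 : ℝ) < blockSize n := by exact_mod_cast blockSize_pos hn
  have hLL : 0 ≤ Real.log (Real.log n) := Real.log_nonneg (by linarith)
  have hs : Real.sqrt (Real.log n) ≤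
      Real.sqrt 8 * blockSize n * Real.sqrt (Real.log (Real.log n)) := by
    have := Real.sqrt_le_sqrt (log_le_blockSize hL)
    rwa [Real.sqrt_mul (by positivity), Real.sqrt_mul (by norm_num),
      Real.sqrt_sq hk.le] at this
  have hL0 : 0 < Real.sqrt (Real.log n) := Real.sqrt_pos.2 (by linarith)
  have hb : (numBlocks n : ℝ) * blockSize n ≤ 2 * n := by exact_mod_cast numBlocks_mul_le hn
  have hrate : 0 ≤ approxRate n := by unfold approxRate; positivity
  rw [Real.norm_of_nonneg (Nat.cast_nonneg _), Real.norm_of_nonneg hrate, approxRate,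
    ← mul_div_assoc, le_div_iff₀ hL0]
  calc (numBlocks n : ℝ) * Real.sqrt (Real.log n)
      ≤ numBlocks n * (Real.sqrt 8 * blockSize n * Real.sqrt (Real.log (Real.log n))) :=
        mul_le_mul_of_nonneg_left hs (Nat.cast_nonneg _)
    _ = numBlocks n * blockSize n * (Real.sqrt 8 * Real.sqrt (Real.log (Real.log n))) := by ring
    _ ≤ 2 * n * (Real.sqrt 8 * Real.sqrt (Real.log (Real.log n))) :=
        mul_le_mul_of_nonneg_right hb (by positivity)
    _ = 2 * Real.sqrt 8 * (n * Real.sqrt (Real.log (Real.log n))) := by ring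

end IntervalDimApprox

/-! ### Decoding the input matrix, and the main theorem -/

theorem relationInput_arr_ne_zero {n : ℕ} (r : Fin n → Fin n → Prop) (i j : Fin n) :
    (relationInput n r).arr 0 (i * n + j) ≠ 0 ↔ r i j := by
  classical
  have h : (∃ i' j' : Fin n, (i : ℕ) * n + j = (i' : ℕ) * n + j' ∧ r i' j') ↔ r i j := by
    refine ⟨?_, fun h => ⟨i, j, rfl, h⟩⟩
    rintro ⟨i', j', h, hr⟩
    have hn : 0 < n := i.pos
    have h1 : ∀ a b : Fin n, ((a : ℕ) * n + b) / n = a ∧ ((a : ℕ) * n + b) % n = b := by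
      intro a b
      rw [Nat.mul_comm, Nat.mul_add_div hn, Nat.mul_add_mod, Nat.div_eq_of_lt b.2,
        Nat.mod_eq_of_lt b.2]
      simp
    have hi : i' = i := Fin.ext (by rw [← (h1 i' j').1, ← h, (h1 i j).1])
    have hj : j' = j := Fin.ext (by rw [← (h1 i' j').2, ← h, (h1 i j).2])
    rwa [hi, hj] at hr
  simp only [relationInput, true_and, h]
  by_cases hr : r i j <;> simp [hr]

theorem mainTheorem7 :
    ∃ (p : RAM.Prog) (T : Polynomial ℕ) (α : ℕ → ℝ),
      α =O[Filter.atTop] approxRate ∧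
      ∀ (n : ℕ), 1 ≤ n → ∀ (X : Type*) [PartialOrder X] (e : Fin n ≃ X),
        ∃ (t : ℕ) (s : RAM.Store),
          RAM.Exec p (relationInput n (fun i j => e i ≤ e j)) t s ∧
          t ≤ T.eval n ∧
          intervalDim X ≤ s.var 0 ∧
          (s.var 0 : ℝ) ≤ α n * (intervalDim X : ℝ) := by
  obtain ⟨p, T, hp⟩ := IntervalDimApprox.exists_prog
  refine ⟨p, T, fun n => IntervalDimApprox.numBlocks n, IntervalDimApprox.numBlocks_isBigO,
    fun n hn X _ e => ?_⟩
  have : Finite X := Finite.of_equiv _ e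
  obtain ⟨t, s, h, ht, hs⟩ := hp n _ (relationInput n fun i j => e i ≤ e j) hn
    (fun i => by simp only [relationInput]; split_ifs <;> simp) (by simp [relationInput]) rfl
  -- The value of `E` at indices from `n` on is arbitrary; only indices below `n` matter.
  let E : ℕ → X := fun i => if hi : i < n then e ⟨i, hi⟩ else e ⟨0, hn⟩
  have hM : ∀ i < n, ∀ j < n,
      (relationInput n fun i j => e i ≤ e j).arr 0 (i * n + j) ≠ 0 ↔ E i ≤ E j := by
    intro i hi j hj
    simp only [E, hi, hj, dif_pos]
    exact relationInput_arr_ne_zero (fun i j => e i ≤ e j) ⟨i, hi⟩ ⟨j, hj⟩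
  refine ⟨t, s, h, ht, ?_, ?_⟩
  · rw [hs]
    refine IntervalDimApprox.intervalDim_le_output hn hM (fun x => e.symm x)
      (fun x => (e.symm x).2) (fun x => ?_) fun i hi => ?_
    · simp [E]
    · simp [E, hi]
  · rw [hs]
    obtain ⟨h0, h1⟩ := intervalDim_spec X
    beta_reduce
    exact_mod_cast IntervalDimApprox.output_le_numBlocks_mul hM h0 h1
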